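/- Let $N\ge 1$. For $1\le i\le N$ let $|\vec i\rangle$ be the $N$-qubit ket with qubit $i$ in state $|1\rangle$ and all other qubits in state $|0\rangle$, let $|\vec 0\rangle=|0\rangle^{\otimes N}$, and let $|W_N\rangle=\frac1{\sqrt N}\sum_{i=1}^N|\vec i\rangle$. An $N$-party W-class state is a unit vector $|\Psi\rangle=(A_1\otimes\cdots\otimes A_N)|W_N\rangle$ with invertible $2\times2$ matrices $A_i$. Let $|\Psi\rangle$ be a W-class state and let $x_0,x_1,\dots,x_N\ge 0$, $\sum_{i=0}^N x_i=1$, be coefficients of it, that is, $|\Psi\rangle=(U_1\otimes\cdots\otimes U_N)\sum_{i=0}^N\sqrt{x_i}\,|\vec i\rangle$ for some unitary $2\times 2$ matrices $U_i$. Write $x_{\min}=\min_{1\le i\le N}x_i$ and $x_{\max}=\max_{1\le i\le N}x_i$ (so $x_{\min}=x_1$ and $x_{\max}=x_N$ if the parties are labelled so that $x_1\le\cdots\le x_N$). Let $P_{\max}(|\Psi\rangle\to|W_N\rangle)$ be the supremum, over all finite-round LOCC protocols in which in each step one party, chosen depending on all earlier outcomes, performs a measurement with finitely many outcomes on its qubit,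 of the total probability of the branches that end in $|W_N\rangle$ up to a phase. Then \[P_{\max}(|\Psi\rangle\to|W_N\rangle)\ \ge\ \frac{2\,x_{\max}\,x_{\min}\,N}{x_0+2x_{\max}+\sqrt{x_0^2+4x_{\max}x_0}}.\] -/

import Mathlib

namespace WDistill

/-- Vectors of `N` qubits, with coordinates in the computational basis: the coordinate at
`s : Fin N → Fin 2` belongs to the basis ket `|s 0, s 1, …, s (N-1)⟩`. -/
abbrev QState (N : ℕ) : Type := EuclideanSpace ℂ (Fin N → Fin 2)

/-- The matrix of the tensor product operator `A 0 ⊗ A 1 ⊗ ⋯ ⊗ A (N-1)`. -/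
def tensorOp {N : ℕ} (A : Fin N → Matrix (Fin 2) (Fin 2) ℂ) :
    Matrix (Fin N → Fin 2) (Fin N → Fin 2) ℂ :=
  Matrix.of fun s t => ∏ i, A i (s i) (t i)

/-- The vector `(A 0 ⊗ ⋯ ⊗ A (N-1)) ψ`. -/
noncomputable def applyOp {N : ℕ} (A : Fin N → Matrix (Fin 2) (Fin 2) ℂ) (ψ : QState N) :
    QState N :=
  WithLp.toLp 2 ((tensorOp A).mulVec ψ.ofLp)

/-- Party `k` applies `M` to its qubit, the other parties do nothing. -/
noncomputable def applyLocal {N : ℕ} (k : Fin N) (M : Matrix (Fin 2) (Fin 2) ℂ) (ψ : QState N) :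
    QState N :=
  applyOp (Function.update (fun _ => 1) k M) ψ

/-- The ket `|0 0 ⋯ 0⟩`. -/
noncomputable def ketZero (N : ℕ) : QState N :=
  EuclideanSpace.single (fun _ => 0) 1

/-- The ket with qubit `i` in state `|1⟩` and all other qubits in state `|0⟩`. -/
noncomputable def ketOne {N : ℕ} (i : Fin N) : QState N :=
  EuclideanSpace.single (fun j => if j = i then 1 else 0) 1

/-- The `N`-party W state `(1/√N) ∑ i, |i⟩`. -/
noncomputable def wState (N : ℕ) : QState N :=
  ((1 / Real.sqrt N : ℝ) : ℂ) • ∑ i : Fin N, ketOne i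

/-- The vector `√x₀ |0 ⋯ 0⟩ + ∑ i, √xᵢ |i⟩`. -/
noncomputable def coeffState {N : ℕ} (x₀ : ℝ) (x : Fin N → ℝ) : QState N :=
  ((Real.sqrt x₀ : ℝ) : ℂ) • ketZero N + ∑ i : Fin N, ((Real.sqrt (x i) : ℝ) : ℂ) • ketOne i

/-- A W-class state: a unit vector obtained from the W state by invertible local operators. -/
def IsWClass {N : ℕ} (Ψ : QState N) : Prop :=
  ‖Ψ‖ = 1 ∧ ∃ A : Fin N → Matrix (Fin 2) (Fin 2) ℂ, (∀ i, IsUnit (A i)) ∧ Ψ = applyOp A (wState N)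

/-- `(x₀, x)` are coefficients of `Ψ`: up to local unitaries, `Ψ` is
`√x₀ |0 ⋯ 0⟩ + ∑ i, √xᵢ |i⟩`. -/
structure IsCoeffVector {N : ℕ} (x₀ : ℝ) (x : Fin N → ℝ) (Ψ : QState N) : Prop where
  zero_nonneg : 0 ≤ x₀
  nonneg : ∀ i, 0 ≤ x i
  sum_eq_one : x₀ + ∑ i, x i = 1
  eq_unitary : ∃ U : Fin N → Matrix (Fin 2) (Fin 2) ℂ,
    (∀ i, U i ∈ Matrix.unitaryGroup (Fin 2) ℂ) ∧ Ψ = applyOp U (coeffState x₀ x)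

/-- A finite-round LOCC protocol, as a tree. At an inner node some party `k` performs a
measurement on its qubit with finitely many outcomes, given by measurement operators `M l` with
`∑ l, (M l)† (M l) = 1`; the outcome is announced, and the rest of the protocol may depend on it. -/
inductive Protocol (N : ℕ) : Type
  | done : Protocol N
  | measure (k : Fin N) (n : ℕ) (M : Fin n → Matrix (Fin 2) (Fin 2) ℂ)
      (complete : ∑ l, (M l).conjTranspose * M l = 1) (next : Fin n → Protocol N) : Protocol N

open Classical in
/-- The probability that the protocol, started in the unit vector `ψ`, ends in the state `φ`
(up to a phase). States along the tree are kept unnormalized, so that the squared norm of the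
vector at a leaf is the product of the outcome probabilities along its branch; a branch is
successful if its final vector is a multiple of `φ`. -/
noncomputable def Protocol.successProb {N : ℕ} (φ : QState N) : Protocol N → QState N → ℝ
  | .done, ψ => if ∃ c : ℂ, ψ = c • φ then ‖ψ‖ ^ 2 else 0
  | .measure k _ M _ next, ψ => ∑ l, Protocol.successProb φ (next l) (applyLocal k (M l) ψ)

/-- The optimal probability of converting the state `ψ` into the state `φ` by LOCC. -/
noncomputable def maxProb {N : ℕ} (ψ φ : QState N) : ℝ :=
  sSup (Set.range fun P : Protocol N => P.successProb φ ψ)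

end WDistill

namespace WDistill

open Matrix
open scoped ComplexOrder MatrixOrder

/-! A single successful branch of a protocol already gives the bound. After the local unitaries are
undone, party `hi` applies an upper triangular contraction that cancels the amplitude of `|0 ⋯ 0⟩`
and scales every other amplitude by `s` (`applyLocal_coeffState`). Each party `i` then damps its
`|1⟩` by `√(x lo / x i)`, which equalises the amplitudes (`applyOp_damping`). What is left is `s √(x
lo) √N` times the W state, so the branch has probability `s² · x lo · N`; `exists_removal_factor`
evaluates `s²`. Any product of local contractions is such a branch
(`norm_sq_le_maxProb_of_contractions`). -/

theorem tensorOp_mul {N : ℕ} (A B : Fin N → Matrix (Fin 2) (Fin 2) ℂ) :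
    tensorOp A * tensorOp B = tensorOp fun i => A i * B i := by
  ext s t
  simp only [tensorOp, Matrix.mul_apply, Matrix.of_apply, ← Finset.prod_mul_distrib]
  rw [Finset.prod_univ_sum]
  simp

theorem tensorOp_one {N : ℕ} :
    tensorOp (fun _ : Fin N => (1 : Matrix (Fin 2) (Fin 2) ℂ)) = 1 := by
  ext s t
  simp only [tensorOp, Matrix.of_apply, Matrix.one_apply]
  rw [Finset.prod_ite_zero]
  simp [funext_iff]

theorem conjTranspose_tensorOp {N : ℕ} (A : Fin N → Matrix (Fin 2) (Fin 2) ℂ) :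
    (tensorOp A)ᴴ = tensorOp fun i => (A i)ᴴ := by
  ext s t
  simp [tensorOp, Matrix.conjTranspose_apply]

theorem tensorOp_update_sum {N n : ℕ} (k : Fin N) (A : Fin N → Matrix (Fin 2) (Fin 2) ℂ)
    (X : Fin n → Matrix (Fin 2) (Fin 2) ℂ) :
    tensorOp (Function.update A k (∑ l, X l)) = ∑ l, tensorOp (Function.update A k (X l)) := by
  have split : ∀ (Y : Matrix (Fin 2) (Fin 2) ℂ) (s t : Fin N → Fin 2),
      tensorOp (Function.update A k Y) s t =
        Y (s k) (t k) * ∏ i ∈ Finset.univ.erase k, A i (s i) (t i) := by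
    intro Y s t
    simp only [tensorOp, Matrix.of_apply]
    rw [← Finset.mul_prod_erase _ _ (Finset.mem_univ k), Function.update_self]
    congr 1
    refine Finset.prod_congr rfl fun i hi => ?_
    rw [Function.update_of_ne (Finset.ne_of_mem_erase hi)]
  ext s t
  simp only [Matrix.sum_apply, split, Finset.sum_mul]

theorem applyOp_applyOp {N : ℕ} (A B : Fin N → Matrix (Fin 2) (Fin 2) ℂ) (ψ : QState N) :
    applyOp A (applyOp B ψ) = applyOp (fun i => A i * B i) ψ := by
  simp [applyOp, ← tensorOp_mul]

theorem applyOp_one {N : ℕ} (ψ : QState N) : applyOp (fun _ => 1) ψ = ψ := by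
  simp [applyOp, tensorOp_one]

theorem applyOp_add {N : ℕ} (A : Fin N → Matrix (Fin 2) (Fin 2) ℂ) (ψ φ : QState N) :
    applyOp A (ψ + φ) = applyOp A ψ + applyOp A φ := by
  simp [applyOp, Matrix.mulVec_add]

theorem applyOp_smul {N : ℕ} (A : Fin N → Matrix (Fin 2) (Fin 2) ℂ) (c : ℂ) (ψ : QState N) :
    applyOp A (c • ψ) = c • applyOp A ψ := by
  simp [applyOp, Matrix.mulVec_smul]

theorem applyOp_sum {N : ℕ} {ι : Type*} (A : Fin N → Matrix (Fin 2) (Fin 2) ℂ) (s : Finset ι)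
    (f : ι → QState N) : applyOp A (∑ i ∈ s, f i) = ∑ i ∈ s, applyOp A (f i) := by
  classical
  induction s using Finset.induction_on with
  | empty => simp [applyOp]
  | insert a s ha ih => rw [Finset.sum_insert ha, Finset.sum_insert ha, applyOp_add, ih]

/-! ### Outcome probabilities and branches of protocols. -/

theorem norm_sq_applyOp {N : ℕ} (A : Fin N → Matrix (Fin 2) (Fin 2) ℂ) (ψ : QState N) :
    ((‖applyOp A ψ‖ ^ 2 : ℝ) : ℂ) =
      star ψ.ofLp ⬝ᵥ (tensorOp fun i => (A i)ᴴ * A i) *ᵥ ψ.ofLp := by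
  rw [← tensorOp_mul, ← conjTranspose_tensorOp, ← Matrix.mulVec_mulVec, Matrix.dotProduct_mulVec,
    ← Matrix.star_mulVec]
  have h := inner_self_eq_norm_sq_to_K (𝕜 := ℂ) (applyOp A ψ)
  rw [EuclideanSpace.inner_eq_star_dotProduct, dotProduct_comm] at h
  simpa [applyOp] using h.symm

/-- The outcome probabilities of a complete measurement add up. -/
theorem sum_norm_sq_applyLocal {N n : ℕ} (k : Fin N) (M : Fin n → Matrix (Fin 2) (Fin 2) ℂ)
    (hM : ∑ l, (M l)ᴴ * M l = 1) (ψ : QState N) :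
    ∑ l, ‖applyLocal k (M l) ψ‖ ^ 2 = ‖ψ‖ ^ 2 := by
  have key : ∀ l, (fun i => (Function.update (fun _ : Fin N => (1 : Matrix (Fin 2) (Fin 2) ℂ))
      k (M l) i)ᴴ *
        Function.update (fun _ : Fin N => (1 : Matrix (Fin 2) (Fin 2) ℂ)) k (M l) i) =
      Function.update (fun _ => 1) k ((M l)ᴴ * M l) := by
    intro l
    ext1 i
    by_cases h : i = k
    · subst h; simp
    · simp [Function.update_of_ne h]
  apply Complex.ofReal_injective
  have h1 := norm_sq_applyOp (fun _ => 1) ψ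
  rw [applyOp_one] at h1
  rw [h1, Complex.ofReal_sum]
  simp only [applyLocal, norm_sq_applyOp, key]
  rw [← dotProduct_sum, ← Matrix.sum_mulVec, ← tensorOp_update_sum, hM]
  congr
  ext1 i
  by_cases h : i = k
  · subst h; simp
  · simp [Function.update_of_ne h]

theorem Protocol.successProb_nonneg {N : ℕ} (φ : QState N) (P : Protocol N) (ψ : QState N) :
    0 ≤ P.successProb φ ψ := by
  induction P generalizing ψ with
  | done => simp only [Protocol.successProb]; split_ifs <;> positivity
  | measure k n M hM next ih => exact Finset.sum_nonneg fun l _ => ih l _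

theorem Protocol.successProb_le {N : ℕ} (φ : QState N) (P : Protocol N) (ψ : QState N) :
    P.successProb φ ψ ≤ ‖ψ‖ ^ 2 := by
  induction P generalizing ψ with
  | done => simp only [Protocol.successProb]; split_ifs <;> simp
  | measure k n M hM next ih =>
    rw [← sum_norm_sq_applyLocal k M hM]
    exact Finset.sum_le_sum fun l _ => ih l _

theorem successProb_le_maxProb {N : ℕ} (φ : QState N) (P : Protocol N) (ψ : QState N) :
    P.successProb φ ψ ≤ maxProb ψ φ :=
  le_csSup ⟨‖ψ‖ ^ 2, by rintro _ ⟨Q, rfl⟩; exact Q.successProb_le φ ψ⟩ ⟨P, rfl⟩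

/-- Local contractions, one for each party of `s`, are a branch of an LOCC protocol. -/
theorem exists_protocol_of_contractions {N : ℕ} (φ : QState N)
    (B : Fin N → Matrix (Fin 2) (Fin 2) ℂ) (hB : ∀ i, (1 - (B i)ᴴ * B i).PosSemidef)
    (s : Finset (Fin N)) :
    ∃ P : Protocol N, ∀ ψ, (∃ c : ℂ, applyOp (fun i => if i ∈ s then B i else 1) ψ = c • φ) →
      ‖applyOp (fun i => if i ∈ s then B i else 1) ψ‖ ^ 2 ≤ P.successProb φ ψ := by
  induction s using Finset.induction_on with
  | empty =>
    refine ⟨.done, fun ψ hψ => ?_⟩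
    simp only [Finset.notMem_empty, if_false, applyOp_one] at hψ ⊢
    simp [Protocol.successProb, hψ]
  | insert a s ha ih =>
    obtain ⟨P, hP⟩ := ih
    -- `C` is the failure outcome completing `B a` to a measurement; the protocol stops there, and
    -- that branch only needs a nonnegative contribution.
    obtain ⟨C, hC⟩ := CStarAlgebra.nonneg_iff_eq_star_mul_self.1 (hB a).nonneg
    refine ⟨.measure a 2 ![B a, C] (by simp [Fin.sum_univ_two, ← Matrix.star_eq_conjTranspose, ← hC]) ![P, .done],
      fun ψ hψ => ?_⟩
    have step : applyOp (fun i => if i ∈ s then B i else 1) (applyLocal a (B a) ψ) =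
        applyOp (fun i => if i ∈ insert a s then B i else 1) ψ := by
      rw [applyLocal, applyOp_applyOp]
      congr 1
      ext1 i
      by_cases h : i = a
      · subst h; simp [ha]
      · simp [h]
    rw [← step] at hψ ⊢
    refine (hP _ hψ).trans ?_
    simp only [Protocol.successProb, Fin.sum_univ_two]
    exact le_add_of_nonneg_right (Protocol.successProb_nonneg _ _ _)

theorem norm_sq_le_maxProb_of_contractions {N : ℕ} (ψ φ : QState N)
    (B : Fin N → Matrix (Fin 2) (Fin 2) ℂ) (hB : ∀ i, (1 - (B i)ᴴ * B i).PosSemidef)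
    (c : ℂ) (h : applyOp B ψ = c • φ) : ‖applyOp B ψ‖ ^ 2 ≤ maxProb ψ φ := by
  obtain ⟨P, hP⟩ := exists_protocol_of_contractions φ B hB Finset.univ
  simp only [Finset.mem_univ, if_true] at hP
  exact (hP ψ ⟨c, h⟩).trans (successProb_le_maxProb φ P ψ)

theorem contraction_mul {A B : Matrix (Fin 2) (Fin 2) ℂ} (hA : (1 - Aᴴ * A).PosSemidef)
    (hB : (1 - Bᴴ * B).PosSemidef) : (1 - (A * B)ᴴ * (A * B)).PosSemidef := by
  have h := (hA.conjTranspose_mul_mul_same B).add hB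
  convert h using 1
  rw [Matrix.conjTranspose_mul]
  noncomm_ring

/-! ### The two local operations on basis kets. -/

theorem applyOp_single_apply {N : ℕ} (A : Fin N → Matrix (Fin 2) (Fin 2) ℂ)
    (t s : Fin N → Fin 2) :
    applyOp A (EuclideanSpace.single t 1) s = ∏ i, A i (s i) (t i) := by
  simp [applyOp, tensorOp]

theorem applyOp_diagonal_single {N : ℕ} (d : Fin N → Fin 2 → ℂ) (t : Fin N → Fin 2) :
    applyOp (fun i => Matrix.diagonal (d i)) (EuclideanSpace.single t 1) =
      (∏ i, d i (t i)) • EuclideanSpace.single t 1 := by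
  ext s
  rw [applyOp_single_apply]
  by_cases h : s = t
  · subst h; simp
  · obtain ⟨i, hi⟩ := Function.ne_iff.1 h
    rw [Finset.prod_eq_zero (Finset.mem_univ i) (Matrix.diagonal_apply_ne (d i) hi)]
    simp [h]

theorem applyLocal_single {N : ℕ} (k : Fin N) (M : Matrix (Fin 2) (Fin 2) ℂ)
    (t : Fin N → Fin 2) :
    applyLocal k M (EuclideanSpace.single t 1) =
      ∑ b, M b (t k) • EuclideanSpace.single (Function.update t k b) (1 : ℂ) := by
  ext s
  rw [applyLocal, applyOp_single_apply]
  by_cases h : ∃ i, i ≠ k ∧ s i ≠ t i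
  · obtain ⟨i, hik, hi⟩ := h
    rw [Finset.prod_eq_zero (Finset.mem_univ i)
      (by rw [Function.update_of_ne hik, Matrix.one_apply_ne hi])]
    have : ∀ b, s ≠ Function.update t k b := by
      rintro b rfl
      exact hi (Function.update_of_ne hik _ _)
    simp [this]
  · push Not at h
    have hs : ∀ b, s = Function.update t k b ↔ s k = b := by
      intro b
      rw [Function.eq_update_iff]
      exact ⟨fun h => h.1, fun hb => ⟨hb, h⟩⟩
    rw [Finset.prod_eq_single k]
    · simp only [hs, WithLp.ofLp_sum, WithLp.ofLp_smul, Finset.sum_apply, Pi.smul_apply,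
        PiLp.single_apply, smul_eq_mul, mul_ite, mul_one, mul_zero, Finset.sum_ite_eq,
        Finset.mem_univ, if_true, Function.update_self]
    · intro i _ hik
      rw [Function.update_of_ne hik, h i hik, Matrix.one_apply_eq]
    · simp

theorem update_ketOne_index {N : ℕ} (i k : Fin N) (h : i ≠ k) :
    Function.update (fun j => if j = i then (1 : Fin 2) else 0) k 0 =
      fun j => if j = i then 1 else 0 := by
  apply Function.update_eq_self_iff.2
  simp [h.symm]

/-- The measurement operator that removes the component along `|0 ⋯ 0⟩`. -/
theorem applyLocal_coeffState {N : ℕ} (k : Fin N) (x₀ : ℝ) (x : Fin N → ℝ) (s : ℝ)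
    (hs : √(x k) * (1 - s ^ 2) = s * √x₀) :
    applyLocal k !![(s : ℂ), -(1 - (s : ℂ) ^ 2); 0, s] (coeffState x₀ x) =
      (s : ℂ) • ∑ i, ((√(x i) : ℝ) : ℂ) • ketOne i := by
  set M : Matrix (Fin 2) (Fin 2) ℂ := !![(s : ℂ), -(1 - (s : ℂ) ^ 2); 0, s] with hM
  have hzero : applyLocal k M (ketZero N) = (s : ℂ) • ketZero N := by
    rw [ketZero, applyLocal_single, Fin.sum_univ_two]
    simp [hM]
  have hone : ∀ i, applyLocal k M (ketOne i) =
      (s : ℂ) • ketOne i + (if i = k then -(1 - (s : ℂ) ^ 2) else 0) • ketZero N := by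
    intro i
    rw [ketOne, applyLocal_single, Fin.sum_univ_two]
    by_cases h : i = k
    · subst h
      have h0 : Function.update (fun j => if j = i then (1 : Fin 2) else 0) i 0 = fun _ => 0 := by
        ext1 j; by_cases h : j = i
        · subst h; simp
        · simp [h]
      have h1 : Function.update (fun j => if j = i then (1 : Fin 2) else 0) i 1 =
          fun j => if j = i then 1 else 0 := Function.update_eq_self_iff.2 (by simp)
      rw [h0, h1]
      simp [hM, ketZero, add_comm]
    · rw [update_ketOne_index i k h]
      simp [hM, h, Ne.symm h]
  -- The amplitude of `|0 ⋯ 0⟩` becomes `s √x₀ - (1 - s²) √(x k)`, which vanishes.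
  have hs' : ((√(x k) : ℝ) : ℂ) * (1 - (s : ℂ) ^ 2) = s * ((√x₀ : ℝ) : ℂ) := by
    exact_mod_cast congrArg Complex.ofReal hs
  rw [applyLocal] at hzero
  simp only [applyLocal] at hone
  rw [coeffState, applyLocal, applyOp_add, applyOp_sum, applyOp_smul, hzero]
  simp only [applyOp_smul, hone, smul_add, Finset.sum_add_distrib, smul_smul, ite_smul,
    zero_smul, Finset.sum_ite_eq', Finset.mem_univ, if_true, Finset.smul_sum, smul_ite, smul_zero]
  rw [mul_neg, hs', neg_smul, mul_comm ((√x₀ : ℝ) : ℂ)]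
  simp [mul_comm]

/-- The difference has rank at most one: it is `1 - s²` times the projector-like matrix `vᴴ v` with
row `v = (1, s)`. The corner entry `-(1 - s²)` is chosen to make this so. -/
theorem contraction_shear (s : ℝ) (hs : s ^ 2 ≤ 1) :
    (1 - (!![(s : ℂ), -(1 - (s : ℂ) ^ 2); 0, s])ᴴ *
      !![(s : ℂ), -(1 - (s : ℂ) ^ 2); 0, s]).PosSemidef := by
  set u : ℝ := √(1 - s ^ 2) with hu
  have hu2 : (u : ℂ) * u = 1 - (s : ℂ) ^ 2 := by
    exact_mod_cast congrArg Complex.ofReal (Real.mul_self_sqrt (sub_nonneg.2 hs))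
  have h := Matrix.posSemidef_conjTranspose_mul_self !![(u : ℂ), s * u; 0, 0]
  convert h using 1
  ext i j
  fin_cases i <;> fin_cases j <;> simp [Matrix.mul_apply, Fin.sum_univ_two]
  · linear_combination -hu2
  · linear_combination -s * hu2
  · linear_combination -s * hu2
  · linear_combination -s ^ 2 * hu2

theorem contraction_damping (d : ℝ) (h0 : 0 ≤ d) (h1 : d ≤ 1) :
    (1 - (Matrix.diagonal ![(1 : ℂ), d])ᴴ * Matrix.diagonal ![(1 : ℂ), d]).PosSemidef := by
  rw [Matrix.diagonal_conjTranspose, Matrix.diagonal_mul_diagonal, ← Matrix.diagonal_one,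
    Matrix.diagonal_sub]
  refine Matrix.PosSemidef.diagonal fun i => ?_
  fin_cases i
  · simp
  · have : (0 : ℝ) ≤ 1 - d * d := by nlinarith
    simpa using (by exact_mod_cast this : (0 : ℂ) ≤ 1 - (d : ℂ) * d)

theorem norm_sq_wState {N : ℕ} (hN : 0 < N) : ‖wState N‖ ^ 2 = 1 := by
  have hon : Orthonormal ℂ (fun i : Fin N => ketOne i) := by
    have hb := (EuclideanSpace.basisFun (Fin N → Fin 2) ℂ).orthonormal
    have hinj : Function.Injective
        (fun i : Fin N => (fun j => if j = i then (1 : Fin 2) else 0)) := by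
      intro i i' h
      by_contra hne
      simpa [hne] using congrFun h i
    simpa [ketOne, Function.comp_def] using hb.comp _ hinj
  have hsum : ‖∑ i : Fin N, ketOne i‖ ^ 2 = N := by
    have h := hon.inner_sum (fun _ => 1) (fun _ => 1) Finset.univ
    simp only [one_smul, inner_self_eq_norm_sq_to_K] at h
    simp only [map_one, mul_one, Finset.sum_const, Finset.card_univ, Fintype.card_fin,
      nsmul_eq_mul] at h
    have h' : ((‖∑ i : Fin N, ketOne i‖ ^ 2 : ℝ) : ℂ) = ((N : ℝ) : ℂ) := by
      push_cast
      exact h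
    exact Complex.ofReal_injective h'
  have : (0 : ℝ) < N := by exact_mod_cast hN
  rw [wState, norm_smul, mul_pow, hsum, Complex.norm_real, Real.norm_eq_abs, sq_abs, div_pow,
    Real.sq_sqrt this.le]
  field_simp

theorem applyOp_damping {N : ℕ} (x : Fin N → ℝ) (m : ℝ) (hm : 0 ≤ m) (hx : ∀ i, m ≤ x i) :
    applyOp (fun i => Matrix.diagonal ![(1 : ℂ), ((√(m / x i) : ℝ) : ℂ)])
      (∑ i, ((√(x i) : ℝ) : ℂ) • ketOne i) = ((√m * √N : ℝ) : ℂ) • wState N := by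
  rcases Nat.eq_zero_or_pos N with rfl | hN
  · simp [wState, applyOp]
  have hN' : √(N : ℝ) ≠ 0 := (Real.sqrt_pos.2 (by exact_mod_cast hN)).ne'
  rw [applyOp_sum, wState, smul_smul, Finset.smul_sum, ← Complex.ofReal_mul]
  refine Finset.sum_congr rfl fun i _ => ?_
  rw [applyOp_smul, ketOne, applyOp_diagonal_single, smul_smul, Finset.prod_eq_single i]
  · congr 1
    simp only [if_true, Matrix.cons_val_one, Matrix.cons_val_zero]
    rw [← Complex.ofReal_mul]
    congr 1
    rw [mul_assoc, mul_one_div_cancel hN', mul_one, ← Real.sqrt_mul (hm.trans (hx i))]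
    -- A vanishing coefficient forces `m = 0`, so both amplitudes are zero.
    rcases eq_or_ne (x i) 0 with h | h
    · rw [h, show m = 0 from le_antisymm (h ▸ hx i) hm]; simp
    · rw [mul_div_cancel₀ _ h]
  · intro j _ hj
    simp [hj]
  · simp

/-- The damping of the removal operator for the component along `|0 ⋯ 0⟩`. -/
theorem exists_removal_factor {a b : ℝ} (ha : 0 ≤ a) (hb : 0 < b) :
    ∃ s : ℝ, s ^ 2 ≤ 1 ∧ √b * (1 - s ^ 2) = s * √a ∧
      s ^ 2 = 2 * b / (a + 2 * b + √(a ^ 2 + 4 * b * a)) := by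
  -- With `a = r²` and `b = w²` the root in the statement factors as `r * q`.
  obtain ⟨r, hr, rfl⟩ : ∃ r : ℝ, 0 ≤ r ∧ r ^ 2 = a := ⟨√a, Real.sqrt_nonneg a, Real.sq_sqrt ha⟩
  obtain ⟨w, hw, rfl⟩ : ∃ w : ℝ, 0 < w ∧ w ^ 2 = b :=
    ⟨√b, Real.sqrt_pos.2 hb, Real.sq_sqrt hb.le⟩
  set q := √(r ^ 2 + 4 * w ^ 2) with hq
  have hq2 : q ^ 2 = r ^ 2 + 4 * w ^ 2 := Real.sq_sqrt (by positivity)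
  have hqpos : 0 < q := Real.sqrt_pos.2 (by positivity)
  have hroot : √((r ^ 2) ^ 2 + 4 * w ^ 2 * r ^ 2) = r * q := by
    rw [show (r ^ 2) ^ 2 + 4 * w ^ 2 * r ^ 2 = (r * q) ^ 2 by rw [mul_pow, hq2]; ring]
    exact Real.sqrt_sq (by positivity)
  rw [hroot, Real.sqrt_sq hr, Real.sqrt_sq hw.le]
  have hden : 0 < r + q := by positivity
  have hden' : 0 < r ^ 2 + 2 * w ^ 2 + r * q := by positivity
  -- The positive root of `w s² + r s - w = 0`, with the square root moved to the denominator.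
  refine ⟨2 * w / (r + q), ?_, ?_, ?_⟩
  · rw [div_pow, div_le_one (by positivity)]
    nlinarith [mul_nonneg hr hqpos.le]
  · field_simp
    linear_combination hq2
  · rw [div_pow, div_eq_div_iff (by positivity) hden'.ne']
    linear_combination -2 * w ^ 2 * hq2

end WDistill

theorem corollary2 {N : ℕ} (Ψ : WDistill.QState N) (hΨ : WDistill.IsWClass Ψ)
    (x₀ : ℝ) (x : Fin N → ℝ) (hx : WDistill.IsCoeffVector x₀ x Ψ)
    (lo hi : Fin N) (hlo : ∀ i, x lo ≤ x i) (hhi : ∀ i, x i ≤ x hi) :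
    2 * x hi * x lo * N / (x₀ + 2 * x hi + Real.sqrt (x₀ ^ 2 + 4 * x hi * x₀)) ≤
      WDistill.maxProb Ψ (WDistill.wState N) := by
  open WDistill in
  open Matrix in
  open scoped ComplexOrder in
  -- If `x hi = 0` the bound is `0`; otherwise `hpos` allows solving for `s`.
  rcases (hx.nonneg hi).eq_or_lt with h0 | hpos
  · rw [← h0]
    simpa using (Protocol.done.successProb_nonneg _ Ψ).trans
      (successProb_le_maxProb (wState N) .done Ψ)
  obtain ⟨U, hU, hΨU⟩ := hx.eq_unitary
  obtain ⟨s, hs1, hs, hsq⟩ := exists_removal_factor hx.zero_nonneg hpos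
  have hUU : ∀ i, (U i)ᴴ * U i = 1 := fun i => Matrix.mem_unitaryGroup_iff'.1 (hU i)
  have hUU' : ∀ i, U i * (U i)ᴴ = 1 := fun i => Matrix.mem_unitaryGroup_iff.1 (hU i)
  set D : Fin N → Matrix (Fin 2) (Fin 2) ℂ :=
    fun i => Matrix.diagonal ![(1 : ℂ), ((√(x lo / x i) : ℝ) : ℂ)] with hD
  set M : Fin N → Matrix (Fin 2) (Fin 2) ℂ :=
    Function.update (fun _ => 1) hi !![(s : ℂ), -(1 - (s : ℂ) ^ 2); 0, s] with hM
  have hfinal : applyOp (fun i => D i * (M i * (U i)ᴴ)) Ψ =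
      ((s * (√(x lo) * √N) : ℝ) : ℂ) • wState N := by
    rw [← applyOp_applyOp D, ← applyOp_applyOp M, hΨU, applyOp_applyOp (fun i => (U i)ᴴ)]
    simp only [hUU, applyOp_one]
    have h := applyLocal_coeffState hi x₀ x s hs
    rw [applyLocal] at h
    rw [h, applyOp_smul, applyOp_damping x (x lo) (hx.nonneg lo) hlo, smul_smul,
      ← Complex.ofReal_mul]
  have hcontr : ∀ i, (1 - (D i * (M i * (U i)ᴴ))ᴴ * (D i * (M i * (U i)ᴴ))).PosSemidef := by
    intro i
    refine contraction_mul ?_ (contraction_mul ?_ ?_)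
    · exact contraction_damping _ (Real.sqrt_nonneg _)
        (Real.sqrt_le_one.2 (div_le_one_of_le₀ (hlo i) (hx.nonneg i)))
    · by_cases h : i = hi
      · subst h
        simpa [hM] using contraction_shear s hs1
      · simpa [hM, Function.update_of_ne h] using Matrix.PosSemidef.zero
    · simpa [hUU'] using Matrix.PosSemidef.zero
  have hle := norm_sq_le_maxProb_of_contractions Ψ (wState N) _ hcontr _ hfinal
  refine le_of_eq_of_le ?_ hle
  rw [hfinal, norm_smul, mul_pow, norm_sq_wState lo.pos, Complex.norm_real, Real.norm_eq_abs,
    sq_abs, mul_pow, mul_pow, hsq, Real.sq_sqrt (hx.nonneg lo), Real.sq_sqrt (Nat.cast_nonneg N)]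
  ring
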